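/- Let $d\in\mathbb R\setminus\{0\}$ and $f_0,\zeta,\mu\in\mathbb R$ be fixed, and let $V:\mathbb R\to\mathbb R$ be $2\pi$-periodic and continuously differentiable. For $\epsilon\in\mathbb R$ consider the stationary perturbed Lugiato--Lefever equation for $2\pi$-periodic functions $u$, $$-d\,u''+\mathrm i\,\epsilon V(x)u'+(\zeta-\mathrm i\mu)u-|u|^2u+\mathrm i f_0=0.\qquad(\ast)_\epsilon$$ Let $u_0\in H^2_{\rm per}([-\pi,\pi],\mathbb C)$ be a non-constant solution of $(\ast)_0$ that is non-degenerate, i.e. the real-linear operator $$L_{u_0}\varphi=-d\varphi''+(\zeta-\mathrm i\mu-2|u_0|^2)\varphi-u_0^2\bar\varphi,\qquad \varphi\in H^2_{\rm per}([-\pi,\pi],\mathbb C),$$ satisfies $\ker L_{u_0}=\operatorname{span}_{\mathbb R}\{u_0'\}$. Let $L_{u_0}^*$ be the adjoint of $L_{u_0}$ with respect to the real inner product $\langle f,g\rangle=\operatorname{Re}\int_{-\pi}^{\pi}f\bar g\,dx$ of $L^2([-\pi,\pi],\mathbb C)$, and let $\phi_0^*\in H^2_{\rm per}([-\pi,\pi],\mathbb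 C)$ be such that $\ker L_{u_0}^*=\operatorname{span}_{\mathbb R}\{\phi_0^*\}$. Suppose that $\sigma_0\in\mathbb R$ is a simple zero of the effective potential $$V_{\rm eff}(\sigma)=\operatorname{Re}\int_{-\pi}^{\pi}\mathrm i\,V(x+\sigma)\,u_0'(x)\,\overline{\phi_0^*(x)}\,dx,$$ that is, $V_{\rm eff}(\sigma_0)=0$ and $V_{\rm eff}'(\sigma_0)\neq0$. Then there exist $\epsilon^*>0$, $C>0$ and a continuous curve $(-\epsilon^*,\epsilon^*)\ni\epsilon\mapsto u(\epsilon)\in H^2_{\rm per}([-\pi,\pi],\mathbb C)$ such that, for all $|\epsilon|<\epsilon^*$, $u(\epsilon)$ is a solution of $(\ast)_\epsilon$ and $$\|u(\epsilon)-u_0(\cdot-\sigma_0)\|_{H^2}\le C|\epsilon|.$$ -/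

import Mathlib

open MeasureTheory Filter Topology Complex

namespace LLE

/-- `u ∈ H²_per([-π,π], ℂ)`. An element of this one-dimensional Sobolev space is represented by its
unique continuous representative, extended `2π`-periodically to `ℝ`: it is `C¹`, its derivative is
absolutely continuous (on one, hence on every, period), and the almost everywhere defined second
derivative, which is then the weak second derivative, is square integrable over a period. -/
structure MemH2per (u : ℝ → ℂ) : Prop where
  periodic : Function.Periodic u (2 * Real.pi)
  contDiff : ContDiff ℝ 1 u
  absolutelyContinuous : AbsolutelyContinuousOnInterval (deriv u) (-Real.pi) Real.pi
  memLp : MemLp (deriv (deriv u)) 2 (volume.restrict (Set.Ioc (-Real.pi) Real.pi))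

/-- The norm of `H²_per([-π,π], ℂ)`. -/
noncomputable def H2norm (u : ℝ → ℂ) : ℝ :=
  Real.sqrt (∫ x in (-Real.pi)..Real.pi,
    (‖u x‖ ^ 2 + ‖deriv u x‖ ^ 2 + ‖deriv (deriv u) x‖ ^ 2))

/-- The real inner product `Re ∫_{-π}^{π} f ḡ dx` of `L²([-π,π], ℂ)`, regarded as a Hilbert space
over `ℝ`. -/
noncomputable def innerL2 (f g : ℝ → ℂ) : ℝ :=
  (∫ x in (-Real.pi)..Real.pi, f x * (starRingEnd ℂ) (g x)).re

/-- Left-hand side of the stationary equation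
`-d u'' + i ε V u' + (ζ - i μ) u - |u|² u + i f₀ = 0`. -/
noncomputable def stationaryLHS (d ζ μ f₀ ε : ℝ) (V : ℝ → ℝ) (u : ℝ → ℂ) (x : ℝ) : ℂ :=
  -(d : ℂ) * deriv (deriv u) x + I * (ε : ℂ) * (V x : ℂ) * deriv u x
    + ((ζ : ℂ) - I * (μ : ℂ)) * u x - (‖u x‖ : ℂ) ^ 2 * u x + I * (f₀ : ℂ)

/-- `u ∈ H²_per` solves the stationary equation. -/
def IsSolution (d ζ μ f₀ ε : ℝ) (V : ℝ → ℝ) (u : ℝ → ℂ) : Prop :=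
  MemH2per u ∧ ∀ᵐ x : ℝ, stationaryLHS d ζ μ f₀ ε V u x = 0

/-- The linearized operator `L_u φ = -d φ'' + (ζ - i μ - 2|u|²) φ - u² φ̄`. -/
noncomputable def linOp (d ζ μ : ℝ) (u φ : ℝ → ℂ) (x : ℝ) : ℂ :=
  -(d : ℂ) * deriv (deriv φ) x
    + ((ζ : ℂ) - I * (μ : ℂ) - 2 * (‖u x‖ : ℂ) ^ 2) * φ x
    - (u x) ^ 2 * (starRingEnd ℂ) (φ x)

/-- The kernel of `L_u : H²_per → L²`. -/
def kerLinOp (d ζ μ : ℝ) (u : ℝ → ℂ) : Set (ℝ → ℂ) :=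
  {φ | MemH2per φ ∧ ∀ᵐ x : ℝ, linOp d ζ μ u φ x = 0}

/-- The kernel of the adjoint `L_u^*` of `L_u` with respect to the real inner product of `L²`:
those `φ` with `⟨L_u ψ, φ⟩ = ⟨ψ, 0⟩ = 0` for all `ψ` in the domain `H²_per` of `L_u`. -/
def kerAdjoint (d ζ μ : ℝ) (u : ℝ → ℂ) : Set (ℝ → ℂ) :=
  {φ | MemH2per φ ∧ ∀ ψ : ℝ → ℂ, MemH2per ψ → innerL2 (linOp d ζ μ u ψ) φ = 0}

/-- `u` is a non-constant solution of the stationary equation at `ε = 0` (where the potential plays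
no role) and is non-degenerate: `ker L_u` is the real span of `u'`. -/
def IsNondegenerateSolution (d ζ μ f₀ : ℝ) (u : ℝ → ℂ) : Prop :=
  IsSolution d ζ μ f₀ 0 (fun _ => 0) u ∧
  (¬ ∃ c : ℂ, ∀ x, u x = c) ∧
  kerLinOp d ζ μ u = (Submodule.span ℝ {deriv u} : Set (ℝ → ℂ))

/-- The effective potential `V_eff(σ) = Re ∫_{-π}^{π} i V(x+σ) u₀'(x) φ̄(x) dx`. -/
noncomputable def Veff (V : ℝ → ℝ) (u₀ φ : ℝ → ℂ) (σ : ℝ) : ℝ :=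
  (∫ x in (-Real.pi)..Real.pi,
    I * (V (x + σ) : ℂ) * deriv u₀ x * (starRingEnd ℂ) (φ x)).re

end LLE

namespace LLE

/-! Lyapunov-Schmidt reduction, packaged as one application of the implicit function theorem. Write
`u(x) = (u₀ + ε w)(x - σ)` with unknowns `w` and `σ`. In the moving frame the shift acts on `V`
alone, so `V ∈ C¹` gives differentiability in `σ`. Subtracting the equation for `u₀` and dividing by
`ε` leaves `L w + i V(· + σ)(u₀' + ε w') - ε (2 u₀ |w|² + ū₀ w²) - ε² |w|² w = 0`, which is regular
at `ε = 0`. A phase condition `ℓ w = 0` with `ℓ u₀' ≠ 0` removes the kernel of `L`.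

At `ε = 0` the derivative in `(w, σ)` is `(w, s) ↦ (L w + s i V'(· + σ₀) u₀', ℓ w)`. On its kernel,
pairing with `φ₀*` gives `s V_eff'(σ₀) = 0`, so `s = 0`; then `w` is a multiple of `u₀'`, and the
phase condition gives `w = 0`. The Fredholm alternative turns this into invertibility
(`isInvertible_linearization`), while `V_eff(σ₀) = 0` makes the problem at `ε = 0` solvable.

The analysis takes place in the sup norm: `u₀` is classical (`IsSolution.exists_classical`), and `w`
is encoded by a continuous `z` through `w = resol z`, `w'' = z - mean z`. The linearization then
becomes the identity minus a compact operator on `CPer × ℝ`. -/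

instance fact_two_pi_pos : Fact (0 < 2 * Real.pi) := ⟨Real.two_pi_pos⟩

/-! ### Continuous periodic functions, their means and primitives. -/

/-- Continuous `2π`-periodic functions. -/
abbrev CPer : Type := C(AddCircle (2 * Real.pi), ℂ)

theorem CPer.periodic (h : CPer) : Function.Periodic (fun x : ℝ => h x) (2 * Real.pi) := by
  intro x
  simp

@[fun_prop]
theorem CPer.continuous_coe (h : CPer) : Continuous (fun x : ℝ => h x) :=
  h.continuous.comp (AddCircle.continuous_mk' _)

theorem CPer.ext_real {h k : CPer} (H : ∀ x : ℝ, h x = k x) : h = k := by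
  ext x
  induction x using QuotientAddGroup.induction_on with
  | H x => exact H x

theorem CPer.norm_le_of_real {h : CPer} {C : ℝ} (hC : 0 ≤ C) (H : ∀ x : ℝ, ‖h x‖ ≤ C) :
    ‖h‖ ≤ C := by
  rw [ContinuousMap.norm_le _ hC]
  intro x
  induction x using QuotientAddGroup.induction_on with
  | H x => exact H x

/-- A continuous periodic function, as an element of `CPer`. -/
noncomputable def CPer.of (f : ℝ → ℂ) (hp : Function.Periodic f (2 * Real.pi))
    (hc : Continuous f) : CPer where
  toFun := hp.lift
  continuous_toFun := continuous_coinduced_dom.mpr hc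

@[simp]
theorem CPer.of_coe (f : ℝ → ℂ) (hp : Function.Periodic f (2 * Real.pi)) (hc : Continuous f)
    (x : ℝ) : CPer.of f hp hc x = f x := rfl

theorem integral_shift {f : ℝ → ℂ} (hp : Function.Periodic f (2 * Real.pi)) (a : ℝ) :
    ∫ t in a..(a + 2 * Real.pi), f t = ∫ t in (-Real.pi)..Real.pi, f t := by
  rw [hp.intervalIntegral_add_eq a (-Real.pi)]
  congr 1
  ring

/-- The mean value over a period. -/
noncomputable def mean : CPer →L[ℝ] ℂ :=
  LinearMap.mkContinuous
    { toFun := fun h => (2 * Real.pi : ℝ)⁻¹ • ∫ t in (-Real.pi)..Real.pi, h (t : ℝ)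
      map_add' := fun h k => by
        simp only [ContinuousMap.add_apply]
        rw [intervalIntegral.integral_add, smul_add] <;>
          exact (CPer.continuous_coe _).intervalIntegrable _ _
      map_smul' := fun c h => by
        simp only [ContinuousMap.smul_apply, RingHom.id_apply]
        rw [intervalIntegral.integral_smul, smul_comm] } 1 fun h => by
    have hpi := Real.pi_pos
    have := intervalIntegral.norm_integral_le_of_norm_le_const
      (f := fun t : ℝ => h t) (a := -Real.pi) (b := Real.pi) (C := ‖h‖)
      (fun x _ => h.norm_coe_le_norm x)
    simp only [LinearMap.coe_mk, AddHom.coe_mk, norm_smul, norm_inv, Real.norm_eq_abs]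
    rw [abs_of_pos (by positivity : (0 : ℝ) < 2 * Real.pi), one_mul,
      inv_mul_le_iff₀ (by positivity)]
    rw [abs_of_pos (by linarith)] at this
    linarith

theorem mean_apply (h : CPer) :
    mean h = (2 * Real.pi : ℝ)⁻¹ • ∫ t in (-Real.pi)..Real.pi, h (t : ℝ) := rfl

theorem norm_mean_le (h : CPer) : ‖mean h‖ ≤ ‖h‖ :=
  (mean.le_of_opNorm_le (LinearMap.mkContinuous_norm_le _ zero_le_one _) h).trans_eq (one_mul _)

/-- Constant functions. -/
noncomputable def constCPer : ℂ →L[ℝ] CPer := (Algebra.linearMap ℂ CPer).restrictScalars ℝ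
  |>.toContinuousLinearMap

@[simp]
theorem constCPer_apply (c : ℂ) (x : AddCircle (2 * Real.pi)) : constCPer c x = c := rfl

theorem periodic_primitive (h : CPer) :
    Function.Periodic (fun x : ℝ => ∫ t in (0 : ℝ)..x, (h t - mean h)) (2 * Real.pi) := by
  intro x
  have hi : ∀ a b : ℝ, IntervalIntegrable (fun t : ℝ => h t - mean h) volume a b := fun a b =>
    Continuous.intervalIntegrable (by fun_prop) _ _
  have hpi := Real.pi_pos
  simp only
  rw [← intervalIntegral.integral_add_adjacent_intervals (hi 0 x) (hi x _),
    integral_shift (f := fun t : ℝ => h t - mean h) (fun y => by simp) x, add_eq_left,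
    intervalIntegral.integral_sub ((CPer.continuous_coe h).intervalIntegrable _ _) (by simp),
    intervalIntegral.integral_const, mean_apply, smul_smul,
    show (Real.pi - -Real.pi) * (2 * Real.pi)⁻¹ = 1 by field_simp; ring, one_smul, sub_self]

theorem continuous_primitive {f : ℝ → ℂ} (hf : Continuous f) (a : ℝ) :
    Continuous fun x => ∫ t in a..x, f t :=
  intervalIntegral.continuous_primitive (fun _ _ => hf.intervalIntegrable _ _) a

theorem norm_sub_mean_le (h : CPer) (x : ℝ) : ‖h x - mean h‖ ≤ 2 * ‖h‖ := by
  have := norm_sub_le (h x) (mean h)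
  have := h.norm_coe_le_norm x
  have := norm_mean_le h
  linarith

/-- The periodic primitive, vanishing at `0`, of `h` minus its mean. -/
noncomputable def prim : CPer →L[ℝ] CPer :=
  LinearMap.mkContinuous
    { toFun := fun h => CPer.of (fun x : ℝ => ∫ t in (0 : ℝ)..x, (h t - mean h))
        (periodic_primitive h) (continuous_primitive (by fun_prop) 0)
      map_add' := fun h k => by
        refine CPer.ext_real fun x => ?_
        simp only [CPer.of_coe, ContinuousMap.add_apply, map_add]
        rw [← intervalIntegral.integral_add] <;>
          first
          | exact Continuous.intervalIntegrable (by fun_prop) _ _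
          | (congr 1; ext t; ring)
      map_smul' := fun c h => by
        refine CPer.ext_real fun x => ?_
        simp only [CPer.of_coe, ContinuousMap.smul_apply, map_smul, RingHom.id_apply, ← smul_sub]
        rw [intervalIntegral.integral_smul] } (4 * Real.pi) fun h => by
    have hpi := Real.pi_pos
    refine CPer.norm_le_of_real (by positivity) fun x => ?_
    -- By periodicity the primitive need only be bounded on `[0, 2π)`, where the integrand is at
    -- most `2 ‖h‖`; hence `4π`.
    obtain ⟨y, hy, hxy⟩ := (periodic_primitive h).exists_mem_Ico Real.two_pi_pos x 0
    have := intervalIntegral.norm_integral_le_of_norm_le_const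
      (f := fun t : ℝ => h t - mean h) (a := 0) (b := y) (C := 2 * ‖h‖)
      (fun x _ => norm_sub_mean_le h x)
    simp only [LinearMap.coe_mk, AddHom.coe_mk, CPer.of_coe]
    rw [hxy]
    refine this.trans ?_
    have h1 : |y - 0| ≤ 2 * Real.pi := by
      rw [sub_zero, abs_of_nonneg hy.1]
      linarith [hy.2]
    nlinarith [norm_nonneg h]

theorem prim_coe (h : CPer) (x : ℝ) : prim h x = ∫ t in (0 : ℝ)..x, (h t - mean h) := rfl

theorem hasDerivAt_prim (h : CPer) (x : ℝ) :
    HasDerivAt (fun y : ℝ => prim h y) (h x - mean h) x :=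
  ((by fun_prop : Continuous fun t : ℝ => h t - mean h).integral_hasStrictDerivAt 0 x).hasDerivAt

theorem norm_sub_le_of_hasDerivAt {h k : CPer}
    (H : ∀ x : ℝ, HasDerivAt (fun y : ℝ => h y) (k x) x) (x y : ℝ) :
    ‖h x - h y‖ ≤ ‖k‖ * |x - y| := by
  simpa using Convex.norm_image_sub_le_of_norm_hasDerivWithin_le (s := Set.univ) (x := y) (y := x)
    (fun z _ => (H z).hasDerivWithinAt) (fun z _ => k.norm_coe_le_norm z) convex_univ
    (Set.mem_univ _) (Set.mem_univ _)

theorem norm_prim_sub_le (h : CPer) (x y : ℝ) :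
    ‖prim h x - prim h y‖ ≤ 2 * ‖h‖ * |x - y| := by
  simpa using Convex.norm_image_sub_le_of_norm_hasDerivWithin_le (s := Set.univ) (x := y) (y := x)
    (fun z _ => (hasDerivAt_prim h z).hasDerivWithinAt) (fun z _ => norm_sub_mean_le h z)
    convex_univ (Set.mem_univ _) (Set.mem_univ _)

/-- Arzelà-Ascoli: `prim` maps the unit ball to a bounded family of functions that are all Lipschitz
with constant 2. -/
theorem isCompactOperator_prim : IsCompactOperator prim := by
  have key := isCompactOperator_iff_isCompact_closure_image_closedBall
    (prim : CPer →ₗ[ℝ] CPer) (r := 1) one_pos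
  refine key.mpr ?_
  let e := ContinuousMap.isometryEquivBoundedOfCompact (AddCircle (2 * Real.pi)) ℂ
  have hcl : IsCompact (closure (e '' (prim '' Metric.closedBall 0 1))) := by
    refine BoundedContinuousFunction.arzela_ascoli (Metric.closedBall (0 : ℂ) (‖prim‖ * 1))
      (isCompact_closedBall _ _) _ ?_ ?_
    · rintro _ x ⟨_, ⟨h, hh, rfl⟩, rfl⟩
      rw [mem_closedBall_zero_iff] at hh ⊢
      calc ‖prim h x‖ ≤ ‖prim h‖ := (prim h).norm_coe_le_norm x
        _ ≤ ‖prim‖ * ‖h‖ := prim.le_opNorm h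
        _ ≤ _ := by gcongr
    · intro x
      induction x using QuotientAddGroup.induction_on with
      | H a =>
        rw [Metric.equicontinuousAt_iff_right]
        intro r hr
        -- The quotient map is open, so points of the circle near `a` lift to reals near `a`; the
        -- radius `r / 2` absorbs the Lipschitz constant 2.
        have hopen : (fun t : ℝ => (t : AddCircle (2 * Real.pi))) '' Metric.ball a (r / 2) ∈
            𝓝 (a : AddCircle (2 * Real.pi)) :=
          (QuotientAddGroup.isOpenMap_coe _ Metric.isOpen_ball).mem_nhds
            ⟨a, Metric.mem_ball_self (by positivity), rfl⟩
        filter_upwards [hopen]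
        rintro _ ⟨b, hb, rfl⟩ ⟨_, ⟨_, ⟨h, hh, rfl⟩, rfl⟩⟩
        rw [mem_closedBall_zero_iff] at hh
        rw [Metric.mem_ball, Real.dist_eq, abs_sub_comm] at hb
        change dist (prim h a) (prim h b) < r
        rw [dist_eq_norm]
        calc ‖prim h a - prim h b‖ ≤ 2 * ‖h‖ * |a - b| := norm_prim_sub_le h a b
          _ ≤ 2 * 1 * |a - b| := by gcongr
          _ < r := by linarith
  have : closure (prim '' Metric.closedBall 0 1) =
      e.symm '' closure (e '' (prim '' Metric.closedBall 0 1)) := by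
    have h := e.symm.toHomeomorph.image_closure (e '' (prim '' Metric.closedBall 0 1))
    simp only [IsometryEquiv.coe_toHomeomorph, Set.image_image, e.symm_apply_apply] at h
    simpa only [Set.image_image] using h.symm
  change IsCompact (closure (prim '' Metric.closedBall 0 1))
  rw [this]
  exact hcl.image e.symm.continuous

/-- `w = resol z` satisfies `w'' = z - mean z`, and `z` is determined by `w`. -/
noncomputable def resol : CPer →L[ℝ] CPer := constCPer ∘L mean + prim ∘L prim

/-- The derivative of `resol z`. -/
noncomputable def resolDeriv : CPer →L[ℝ] CPer := prim - (constCPer ∘L mean) ∘L prim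

/-- The second derivative of `resol z`. -/
noncomputable def resolDeriv2 : CPer →L[ℝ] CPer := .id ℝ CPer - constCPer ∘L mean

theorem resolDeriv2_apply (z : CPer) : resolDeriv2 z = z - constCPer (mean z) := rfl

theorem hasDerivAt_resol (z : CPer) (x : ℝ) :
    HasDerivAt (fun y : ℝ => resol z y) (resolDeriv z x) x :=
  (hasDerivAt_prim (prim z) x).const_add (mean z)

theorem hasDerivAt_resolDeriv (z : CPer) (x : ℝ) :
    HasDerivAt (fun y : ℝ => resolDeriv z y) (resolDeriv2 z x) x :=
  (hasDerivAt_prim z x).sub_const (mean (prim z))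

theorem eq_zero_of_hasDerivAt {h k : CPer}
    (H : ∀ x : ℝ, HasDerivAt (fun y : ℝ => h y) (k x) x) (h0 : h = 0) : k = 0 := by
  subst h0
  exact CPer.ext_real fun x => (H x).unique (hasDerivAt_const x (0 : ℂ))

theorem prim_const (c : ℂ) : prim (constCPer c) = 0 := by
  have hm : mean (constCPer c) = c := by
    have hpi := Real.pi_pos
    simp only [mean_apply, constCPer_apply, intervalIntegral.integral_const, smul_smul]
    rw [show (2 * Real.pi)⁻¹ * (Real.pi - -Real.pi) = 1 by field_simp; ring, one_smul]
  refine CPer.ext_real fun x => ?_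
  simp [prim_coe, hm]

/-- Differentiating `resol z = 0` twice shows that `z` is constant, and `resol` fixes constants. The
summand `constCPer ∘L mean` in `resol` is there to recover the mean, which the second derivative
loses. -/
theorem resol_injective {z : CPer} (hz : resol z = 0) : z = 0 := by
  have h2 : z = constCPer (mean z) := sub_eq_zero.mp <|
    eq_zero_of_hasDerivAt (hasDerivAt_resolDeriv z) <|
      eq_zero_of_hasDerivAt (hasDerivAt_resol z) hz
  have h3 : resol z = constCPer (mean z) + prim (prim z) := rfl
  rw [h2, prim_const, map_zero, add_zero, ← h2, ← h2] at h3
  rw [← h3, hz]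

theorem isCompactOperator_resol : IsCompactOperator resol :=
  IsCompactOperator.add
    ((isCompactOperator_of_locallyCompactSpace_rng constCPer).comp_clm mean)
    (isCompactOperator_prim.comp_clm prim)

theorem isCompactOperator_const_mean : IsCompactOperator (constCPer ∘L mean) :=
  (isCompactOperator_of_locallyCompactSpace_rng constCPer).comp_clm mean

/-! ### Fredholm alternative. -/

/-- The Fredholm alternative for a compact perturbation of the identity. -/
theorem isInvertible_one_sub_of_isCompactOperator {X : Type*} [NormedAddCommGroup X]
    [NormedSpace ℝ X] [CompleteSpace X] {K : X →L[ℝ] X} (hK : IsCompactOperator K)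
    (hinj : ∀ p, p - K p = 0 → p = 0) : (1 - K).IsInvertible := by
  rcases hK.hasEigenvalue_or_mem_resolventSet (one_ne_zero (α := ℝ)) with h | h
  · obtain ⟨p, hp⟩ := h.exists_hasEigenvector
    refine absurd (hinj p ?_) hp.2
    have := hp.apply_eq_smul
    rw [one_smul] at this
    rw [sub_eq_zero]
    exact this.symm
  · rw [spectrum.mem_resolventSet_iff, map_one] at h
    obtain ⟨u, hu⟩ := h
    exact ⟨ContinuousLinearEquiv.unitsEquiv ℝ X u, by ext x; rw [← hu]; rfl⟩

/-! ### Classical derivatives and membership in `H²_per`. -/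

/-- `k` is the derivative of `h`. -/
def CPer.HasDeriv (h k : CPer) : Prop :=
  ∀ x : ℝ, HasDerivAt (fun y : ℝ => h y) (k x) x

theorem CPer.HasDeriv.shift {h k : CPer} (H : h.HasDeriv k) (a x : ℝ) :
    HasDerivAt (fun y : ℝ => h ((y - a : ℝ))) (k ((x - a : ℝ))) x :=
  (H (x - a)).comp_sub_const x a

theorem CPer.HasDeriv.deriv_shift {h k : CPer} (H : h.HasDeriv k) (a : ℝ) :
    deriv (fun y : ℝ => h ((y - a : ℝ))) = fun x : ℝ => k ((x - a : ℝ)) :=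
  funext fun x => (H.shift a x).deriv

theorem CPer.HasDeriv.deriv {h k : CPer} (H : h.HasDeriv k) :
    deriv (fun y : ℝ => h y) = fun x : ℝ => k x :=
  funext fun x => (H x).deriv

theorem CPer.HasDeriv.add_smul {h k h' k' : CPer} (H : h.HasDeriv k) (H' : h'.HasDeriv k')
    (c : ℝ) : (h + c • h').HasDeriv (k + c • k') :=
  fun x => (H x).add ((H' x).const_smul c)

theorem memH2per_shift {f f₁ f₂ : CPer} (h₁ : f.HasDeriv f₁) (h₂ : f₁.HasDeriv f₂) (a : ℝ) :
    MemH2per (fun x : ℝ => f ((x - a : ℝ))) where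
  periodic := fun x => by
    simpa only [sub_add_eq_add_sub] using f.periodic (x - a)
  contDiff := by
    rw [contDiff_one_iff_deriv, h₁.deriv_shift a]
    exact ⟨fun x => (h₁.shift a x).differentiableAt, f₁.continuous_coe.comp (by fun_prop)⟩
  absolutelyContinuous := by
    refine ContDiffOn.absolutelyContinuousOnInterval (ContDiff.contDiffOn ?_)
    rw [h₁.deriv_shift a, contDiff_one_iff_deriv, h₂.deriv_shift a]
    exact ⟨fun x => (h₂.shift a x).differentiableAt, f₂.continuous_coe.comp (by fun_prop)⟩
  memLp := by
    rw [h₁.deriv_shift a, h₂.deriv_shift a]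
    refine MemLp.of_bound
      (f₂.continuous_coe.comp (by fun_prop : Continuous fun x : ℝ => x - a)).aestronglyMeasurable
      ‖f₂‖ (Eventually.of_forall fun x => f₂.norm_coe_le_norm _)

theorem memH2per_coe {f f₁ f₂ : CPer} (h₁ : f.HasDeriv f₁) (h₂ : f₁.HasDeriv f₂) :
    MemH2per (fun x : ℝ => f x) := by
  simpa using memH2per_shift h₁ h₂ 0

theorem H2norm_le {f f₁ f₂ : ℝ → ℂ} (h₁ : deriv f = f₁) (h₂ : deriv f₁ = f₂) {M : ℝ}
    (hM : 0 ≤ M) (b : ∀ x, ‖f x‖ ≤ M) (b₁ : ∀ x, ‖f₁ x‖ ≤ M) (b₂ : ∀ x, ‖f₂ x‖ ≤ M) :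
    H2norm f ≤ Real.sqrt (6 * Real.pi) * M := by
  have hpi := Real.pi_pos
  rw [H2norm, h₁, h₂, ← Real.sqrt_sq hM, ← Real.sqrt_mul (by positivity)]
  refine Real.sqrt_le_sqrt ?_
  have := intervalIntegral.norm_integral_le_of_norm_le_const
    (f := fun x => ‖f x‖ ^ 2 + ‖f₁ x‖ ^ 2 + ‖f₂ x‖ ^ 2) (a := -Real.pi) (b := Real.pi)
    (C := 3 * M ^ 2) (fun x _ => by
      rw [Real.norm_of_nonneg (by positivity)]
      have := pow_le_pow_left₀ (norm_nonneg _) (b x) 2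
      have := pow_le_pow_left₀ (norm_nonneg _) (b₁ x) 2
      have := pow_le_pow_left₀ (norm_nonneg _) (b₂ x) 2
      linarith)
  rw [abs_of_pos (by linarith)] at this
  have := (le_abs_self _).trans this
  linarith

/-! ### Regularity of the unperturbed solution. -/

theorem hasDerivAt_of_eq_primitive {g q : ℝ → ℂ} (hg : Function.Periodic g (2 * Real.pi))
    (hq : Function.Periodic q (2 * Real.pi)) (hqc : Continuous q) {c : ℂ}
    (H : ∀ x ∈ Set.Icc (-Real.pi) Real.pi, g x = c + ∫ t in (-Real.pi)..x, q t) (x : ℝ) :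
    HasDerivAt g (q x) x := by
  have hpi := Real.pi_pos
  -- Since `g π = g (-π)`, `q` has zero integral over a period, so the primitive is periodic and the
  -- identity on one period extends to `ℝ`.
  have hper : Function.Periodic (fun x => c + ∫ t in (-Real.pi)..x, q t) (2 * Real.pi) := by
    intro x
    have h1 := H Real.pi ⟨by linarith, le_rfl⟩
    have h2 := H (-Real.pi) ⟨le_rfl, by linarith⟩
    have h3 := hg (-Real.pi)
    rw [show -Real.pi + 2 * Real.pi = Real.pi by ring, h1, h2, intervalIntegral.integral_same] at h3
    simp only
    rw [← intervalIntegral.integral_add_adjacent_intervals (hqc.intervalIntegrable _ x)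
      (hqc.intervalIntegrable _ _), integral_shift hq, add_left_cancel h3, add_zero]
  have heq : g = fun x => c + ∫ t in (-Real.pi)..x, q t := by
    funext x
    obtain ⟨y, hy, hxy⟩ := (hg.sub hper).exists_mem_Ico Real.two_pi_pos x (-Real.pi)
    refine sub_eq_zero.mp (hxy.trans (sub_eq_zero.mpr (H y ⟨hy.1, ?_⟩)))
    linarith [hy.2]
  rw [heq]
  exact (hqc.integral_hasStrictDerivAt (-Real.pi) x).hasDerivAt.const_add c

theorem absolutelyContinuousOnInterval_comp_lipschitz {X Y : Type*} [PseudoMetricSpace X]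
    [PseudoMetricSpace Y] {f : ℝ → X} {φ : X → Y} {a b : ℝ} (hφ : LipschitzWith 1 φ)
    (hf : AbsolutelyContinuousOnInterval f a b) :
    AbsolutelyContinuousOnInterval (fun x => φ (f x)) a b := by
  rw [absolutelyContinuousOnInterval_iff] at hf ⊢
  intro ε hε
  obtain ⟨δ, hδ, H⟩ := hf ε hε
  refine ⟨δ, hδ, fun E hE hlt => (Finset.sum_le_sum fun i _ => ?_).trans_lt (H E hE hlt)⟩
  simpa using hφ.dist_le_mul (f (E.2 i).1) (f (E.2 i).2)

/-- Real and imaginary parts inherit absolute continuity, and each is differentiable almost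
everywhere. -/
theorem ae_differentiableAt_of_absolutelyContinuous {f : ℝ → ℂ} {a b : ℝ}
    (hf : AbsolutelyContinuousOnInterval f a b) :
    ∀ᵐ x : ℝ, x ∈ Set.uIcc a b → DifferentiableAt ℝ f x := by
  have hre := (absolutelyContinuousOnInterval_comp_lipschitz (φ := Complex.re)
    (LipschitzWith.of_dist_le_mul fun x y => by
      simpa [Real.dist_eq, dist_eq_norm] using abs_re_le_norm (x - y)) hf).ae_differentiableAt
  have him := (absolutelyContinuousOnInterval_comp_lipschitz (φ := Complex.im)
    (LipschitzWith.of_dist_le_mul fun x y => by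
      simpa [Real.dist_eq, dist_eq_norm] using abs_im_le_norm (x - y)) hf).ae_differentiableAt
  filter_upwards [hre, him] with x h1 h2 hx
  have h3 := ((h1 hx).hasDerivAt.ofReal_comp).add
    ((h2 hx).hasDerivAt.ofReal_comp.mul_const I)
  refine (h3.congr_of_eventuallyEq (Eventually.of_forall fun y => ?_)).differentiableAt
  simp [Complex.re_add_im]

theorem eq_primitive_of_absolutelyContinuous {f q : ℝ → ℂ} {a b : ℝ} (hab : a ≤ b)
    (hf : AbsolutelyContinuousOnInterval f a b) (hq : Continuous q)
    (H : ∀ᵐ x : ℝ, deriv f x = q x) :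
    ∀ x ∈ Set.Icc a b, f x = f a + ∫ t in a..x, q t := by
  have hd : ∀ x, HasDerivAt (fun x => ∫ t in a..x, q t) (q x) x :=
    fun x => (hq.integral_hasStrictDerivAt a x).hasDerivAt
  have hq' : AbsolutelyContinuousOnInterval (fun x => ∫ t in a..x, q t) a b := by
    refine ContDiffOn.absolutelyContinuousOnInterval (ContDiff.contDiffOn ?_)
    rw [contDiff_one_iff_deriv, funext fun x => (hd x).deriv]
    exact ⟨fun x => (hd x).differentiableAt, hq⟩
  obtain ⟨C, hC⟩ := (hf.sub hq').const_of_ae_hasDerivAt_zero (by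
    filter_upwards [H, ae_differentiableAt_of_absolutelyContinuous hf] with x h1 h2 hx
    have := (h2 hx).hasDerivAt.sub (hd x)
    rwa [h1, sub_self] at this)
  rw [Set.uIcc_of_le hab] at hC
  intro x hx
  have h1 := hC x hx
  have h2 := hC a ⟨le_rfl, hab⟩
  simp only [Pi.sub_apply, intervalIntegral.integral_same, sub_zero] at h1 h2
  rw [h2, ← h1]
  ring

theorem CPer.HasDeriv.mul {h k h' k' : CPer} (H : h.HasDeriv k) (H' : h'.HasDeriv k') :
    (h * h').HasDeriv (k * h' + h * k') :=
  fun x => (H x).mul (H' x)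

theorem CPer.HasDeriv.star {h k : CPer} (H : h.HasDeriv k) :
    (star h).HasDeriv (star k) :=
  fun x => (H x).star

theorem norm_sq_mul_eq (z : ℂ) : (‖z‖ : ℂ) ^ 2 = z * (starRingEnd ℂ) z := by
  rw [Complex.mul_conj']

/-- Solutions of the unperturbed equation are classical and three times differentiable. -/
theorem IsSolution.exists_classical {d ζ μ f₀ : ℝ} (hd : d ≠ 0) {u : ℝ → ℂ}
    (hu : IsSolution d ζ μ f₀ 0 (fun _ => 0) u) :
    ∃ U U₁ U₂ U₃ : CPer, (u = fun x : ℝ => U x) ∧ U.HasDeriv U₁ ∧ U₁.HasDeriv U₂ ∧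
      U₂.HasDeriv U₃ ∧ ∀ x : ℝ, -(d : ℂ) * U₂ x + ((ζ : ℂ) - I * (μ : ℂ)) * U x
        - U x * U x * (starRingEnd ℂ) (U x) + I * (f₀ : ℂ) = 0 := by
  obtain ⟨hm, heq⟩ := hu
  have hd' : (d : ℂ) ≠ 0 := by exact_mod_cast hd
  have hpi := Real.pi_pos
  have hu1 := contDiff_one_iff_deriv.mp hm.contDiff
  have hper1 : Function.Periodic (deriv u) (2 * Real.pi) := by
    intro x
    rw [← deriv_comp_add_const]
    congr 1
    exact funext hm.periodic
  let U : CPer := CPer.of u hm.periodic hm.contDiff.continuous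
  let U₁ : CPer := CPer.of (deriv u) hper1 hu1.2
  -- The equation solved for `u''`. Its right-hand side is continuous and equals `u''` almost
  -- everywhere, so the absolutely continuous `u'` is its primitive; since it is a polynomial in `u`
  -- and `ū`, it can be differentiated once more.
  let U₂ : CPer := (d : ℂ)⁻¹ • (((ζ : ℂ) - I * (μ : ℂ)) • U - U * U * star U
    + constCPer (I * (f₀ : ℂ)))
  have h01 : U.HasDeriv U₁ := fun x => (hu1.1 x).hasDerivAt
  have hU₂ : ∀ x : ℝ, U₂ x = (d : ℂ)⁻¹ * (((ζ : ℂ) - I * (μ : ℂ)) * u x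
      - u x * u x * (starRingEnd ℂ) (u x) + I * (f₀ : ℂ)) := fun x => rfl
  have h12 : U₁.HasDeriv U₂ := by
    refine hasDerivAt_of_eq_primitive U₁.periodic U₂.periodic U₂.continuous_coe
      (eq_primitive_of_absolutelyContinuous (by linarith) hm.absolutelyContinuous
        U₂.continuous_coe ?_)
    filter_upwards [heq] with x hx
    simp only [stationaryLHS, norm_sq_mul_eq] at hx
    change deriv (deriv u) x = _
    rw [hU₂, eq_inv_mul_iff_mul_eq₀ hd']
    push_cast at hx
    linear_combination -hx
  refine ⟨U, U₁, U₂, (d : ℂ)⁻¹ • (((ζ : ℂ) - I * (μ : ℂ)) • U₁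
    - ((U₁ * U + U * U₁) * star U + U * U * star U₁)), rfl, h01, h12, ?_, ?_⟩
  · intro x
    have := (((h01 x).const_smul ((ζ : ℂ) - I * (μ : ℂ))).sub
      (((h01.mul h01).mul h01.star) x)).add_const (I * (f₀ : ℂ)) |>.const_smul (d : ℂ)⁻¹
    exact this
  · intro x
    rw [hU₂]
    have : U x = u x := rfl
    rw [this, neg_mul, mul_inv_cancel_left₀ hd']
    ring

/-! ### Differentiability of translation in the sup norm. -/

/-- Translation of a continuous periodic function. -/
noncomputable def CPer.translate (h : CPer) (s : ℝ) : CPer :=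
  h.comp ⟨fun x => x + (s : AddCircle (2 * Real.pi)), by fun_prop⟩

theorem CPer.translate_coe (h : CPer) (s x : ℝ) : h.translate s x = h ((x + s : ℝ)) := rfl

theorem CPer.continuous_translate (h : CPer) : Continuous h.translate := by
  refine ContinuousMap.continuous_of_continuous_uncurry _ ?_
  have : Continuous fun p : ℝ × AddCircle (2 * Real.pi) => h (p.2 + (p.1 : AddCircle _)) :=
    h.continuous.comp (continuous_snd.add ((AddCircle.continuous_mk' _).comp continuous_fst))
  exact this

theorem CPer.HasDeriv.hasDerivAt_translate {h k : CPer} (H : h.HasDeriv k) (s : ℝ) :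
    HasDerivAt h.translate (k.translate s) s := by
  -- Pointwise this is the fundamental theorem of calculus; reading it as a `CPer`-valued integral
  -- makes the derivative in `s` uniform in `x`.
  have key : h.translate = fun s => h.translate 0 + ∫ t in (0 : ℝ)..s, k.translate t := by
    funext s
    refine CPer.ext_real fun x => ?_
    have h1 := (ContinuousMap.evalCLM (M := ℂ) ℝ
      (x : AddCircle (2 * Real.pi))).intervalIntegral_comp_comm
      (k.continuous_translate.intervalIntegrable (μ := volume) 0 s)
    have h2 : ∀ t ∈ Set.uIcc 0 s, HasDerivAt (fun t : ℝ => h ((x + t : ℝ)))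
        (k ((x + t : ℝ))) t := fun t _ => (H (x + t)).comp_const_add x t
    have h3 := intervalIntegral.integral_eq_sub_of_hasDerivAt h2
      (Continuous.intervalIntegrable (k.continuous_coe.comp (by fun_prop)) _ _)
    have h4 : (∫ t in (0 : ℝ)..s, k.translate t) (x : AddCircle (2 * Real.pi)) =
        ∫ t in (0 : ℝ)..s, k ((x + t : ℝ)) := h1.symm
    rw [ContinuousMap.add_apply, h4, h3, CPer.translate_coe, CPer.translate_coe]
    ring
  rw [key]
  exact (k.continuous_translate.integral_hasStrictDerivAt 0 s).hasDerivAt.const_add _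

theorem CPer.HasDeriv.contDiff_translate {h k : CPer} (H : h.HasDeriv k) :
    ContDiff ℝ 1 h.translate := by
  rw [contDiff_one_iff_deriv, funext fun s => (H.hasDerivAt_translate s).deriv]
  exact ⟨fun s => (H.hasDerivAt_translate s).differentiableAt, k.continuous_translate⟩

/-! ### The linearized problem and its invertibility. -/

/-- Complex conjugation on `CPer`. -/
noncomputable def conjCPer : CPer →L[ℝ] CPer := (starL' ℝ : CPer ≃L[ℝ] CPer)

@[simp]
theorem conjCPer_apply (h : CPer) (x : AddCircle (2 * Real.pi)) :
    conjCPer h x = (starRingEnd ℂ) (h x) := rfl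

/-- The zeroth order part of the linearization at `U`. -/
noncomputable def linPart (ζ μ : ℝ) (U : CPer) : CPer →L[ℝ] CPer :=
  ((ζ : ℂ) - I * (μ : ℂ)) • ContinuousLinearMap.id ℝ CPer
    - (2 : ℂ) • ContinuousLinearMap.mul ℝ CPer (U * conjCPer U)
    - (ContinuousLinearMap.mul ℝ CPer (U * U)) ∘L conjCPer

theorem linPart_apply (ζ μ : ℝ) (U h : CPer) (x : AddCircle (2 * Real.pi)) :
    linPart ζ μ U h x = ((ζ : ℂ) - I * (μ : ℂ)) * h x
      - 2 * (U x * (starRingEnd ℂ) (U x) * h x) - U x * U x * (starRingEnd ℂ) (h x) := rfl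

theorem linOp_coe (d ζ μ : ℝ) (U : CPer) {f f₁ f₂ : CPer} (h₁ : f.HasDeriv f₁)
    (h₂ : f₁.HasDeriv f₂) :
    linOp d ζ μ (fun x : ℝ => U x) (fun x : ℝ => f x) =
      fun x : ℝ => (linPart ζ μ U f - d • f₂) x := by
  funext x
  simp only [linOp, h₁.deriv, h₂.deriv, norm_sq_mul_eq, ContinuousMap.sub_apply, linPart_apply,
    ContinuousMap.smul_apply, real_smul]
  ring

/-- The real `L²` pairing with `φ`. -/
noncomputable def pairing (φ : CPer) : CPer →L[ℝ] ℝ :=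
  (2 * Real.pi) • (reCLM ∘L mean ∘L (ContinuousLinearMap.mul ℝ CPer (conjCPer φ)))

theorem pairing_apply (φ h : CPer) :
    pairing φ h = (∫ x in (-Real.pi)..Real.pi, h (x : ℝ) * (starRingEnd ℂ) (φ (x : ℝ))).re := by
  have hpi := Real.pi_pos
  change (2 * Real.pi) * (mean (conjCPer φ * h)).re = _
  rw [mean_apply, smul_re, smul_eq_mul, mul_inv_cancel_left₀ (by positivity)]
  simp only [ContinuousMap.mul_apply, conjCPer_apply, mul_comm]

/-- The compact part of the linearized problem for `(z, s)`. -/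
noncomputable def compactPart (d : ℝ) (A : CPer →L[ℝ] CPer) (g : CPer) (ℓ : CPer →L[ℝ] ℝ) :
    CPer × ℝ →L[ℝ] CPer × ℝ :=
  (.inl ℝ CPer ℝ ∘L (constCPer ∘L mean + (d⁻¹ • A) ∘L resol)) ∘L .fst ℝ CPer ℝ
    + (((ContinuousLinearMap.toSpanSingleton ℝ (d⁻¹ • g)) ∘L .fst ℝ ℝ ℝ).prod
        (.fst ℝ ℝ ℝ - .snd ℝ ℝ ℝ)) ∘L
      ((ContinuousLinearMap.snd ℝ CPer ℝ).prod ((ℓ ∘L resol) ∘L .fst ℝ CPer ℝ))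

theorem one_sub_compactPart_apply (d : ℝ) (A : CPer →L[ℝ] CPer) (g : CPer) (ℓ : CPer →L[ℝ] ℝ)
    (p : CPer × ℝ) : (1 - compactPart d A g ℓ) p =
      (resolDeriv2 p.1 - d⁻¹ • (A (resol p.1) + p.2 • g), ℓ (resol p.1)) := by
  have h : compactPart d A g ℓ p = (constCPer (mean p.1) + d⁻¹ • A (resol p.1) + p.2 • d⁻¹ • g,
      0 + (p.2 - ℓ (resol p.1))) := rfl
  rw [sub_apply, h, one_apply_eq_self, resolDeriv2_apply]
  ext1
  · simp only [Prod.fst_sub, smul_add, smul_comm p.2]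
    abel
  · simp

theorem isCompactOperator_compactPart (d : ℝ) (A : CPer →L[ℝ] CPer) (g : CPer)
    (ℓ : CPer →L[ℝ] ℝ) : IsCompactOperator (compactPart d A g ℓ) := by
  refine IsCompactOperator.add ?_ ?_
  · exact ((isCompactOperator_const_mean.add
      (isCompactOperator_resol.clm_comp (d⁻¹ • A))).clm_comp (.inl ℝ CPer ℝ)).comp_clm
        (.fst ℝ CPer ℝ)
  · exact (isCompactOperator_of_locallyCompactSpace_rng
      (((ContinuousLinearMap.toSpanSingleton ℝ (d⁻¹ • g)) ∘L ContinuousLinearMap.fst ℝ ℝ ℝ).prod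
        (ContinuousLinearMap.fst ℝ ℝ ℝ - ContinuousLinearMap.snd ℝ ℝ ℝ))).comp_clm
      ((ContinuousLinearMap.snd ℝ CPer ℝ).prod ((ℓ ∘L resol) ∘L .fst ℝ CPer ℝ))

/-- Here `P` is the pairing with `φ₀*`, which annihilates the range of `L`. With `k = 0` this yields
injectivity; with `k = i V(· + σ₀) u₀'` it yields solvability at `ε = 0`. -/
theorem pairing_identity {d : ℝ} (hd : d ≠ 0) {A : CPer →L[ℝ] CPer} {g k : CPer}
    {ℓ P : CPer →L[ℝ] ℝ}
    (hP : ∀ f f₁ f₂ : CPer, f.HasDeriv f₁ → f₁.HasDeriv f₂ → P (A f - d • f₂) = 0)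
    {p : CPer × ℝ} {r : ℝ} (hp : (1 - compactPart d A g ℓ) p = (d⁻¹ • k, r)) :
    A (resol p.1) - d • resolDeriv2 p.1 + (p.2 • g + k) = 0 ∧ p.2 * P g + P k = 0 := by
  rw [one_sub_compactPart_apply, Prod.mk.injEq, sub_eq_iff_eq_add, ← smul_add] at hp
  have h1 : d • resolDeriv2 p.1 = k + (A (resol p.1) + p.2 • g) := by
    rw [hp.1, smul_inv_smul₀ hd]
  have h2 : A (resol p.1) - d • resolDeriv2 p.1 + (p.2 • g + k) = 0 := by
    rw [h1]
    abel
  refine ⟨h2, ?_⟩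
  have h3 := congrArg P h2
  rwa [map_add, hP _ _ _ (hasDerivAt_resol p.1) (hasDerivAt_resolDeriv p.1), map_add, map_smul,
    map_zero, zero_add, smul_eq_mul] at h3

theorem isInvertible_linearization {d : ℝ} (hd : d ≠ 0) {A : CPer →L[ℝ] CPer} {g U₁ : CPer}
    {ℓ P : CPer →L[ℝ] ℝ}
    (hP : ∀ f f₁ f₂ : CPer, f.HasDeriv f₁ → f₁.HasDeriv f₂ → P (A f - d • f₂) = 0)
    (hker : ∀ f f₁ f₂ : CPer, f.HasDeriv f₁ → f₁.HasDeriv f₂ → A f - d • f₂ = 0 →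
      ∃ c : ℝ, f = c • U₁) (hg : P g ≠ 0) (hℓ : ℓ U₁ ≠ 0) :
    (1 - compactPart d A g ℓ).IsInvertible := by
  refine isInvertible_one_sub_of_isCompactOperator (isCompactOperator_compactPart d A g ℓ)
    fun p hp => ?_
  have hp' : (1 - compactPart d A g ℓ) p = (d⁻¹ • (0 : CPer), (0 : ℝ)) := by
    rw [smul_zero]
    exact hp
  obtain ⟨h1, h2⟩ := pairing_identity hd hP hp'
  have hs : p.2 = 0 := by simpa [hg] using h2
  rw [hs, zero_smul, add_zero, add_zero] at h1
  obtain ⟨c, hc⟩ := hker _ _ _ (hasDerivAt_resol p.1) (hasDerivAt_resolDeriv p.1) h1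
  rw [one_sub_compactPart_apply, Prod.mk.injEq] at hp'
  have hc0 : c = 0 := by simpa [hc, hℓ] using hp'.2
  refine Prod.ext (resol_injective ?_) hs
  rw [hc, hc0, zero_smul]

/-! ### The rescaled equation and the implicit function theorem. -/

/-- The rescaled stationary equation for `(ε, (z, σ))` together with a phase condition. -/
noncomputable def rescaledResidual (d ζ μ : ℝ) (U U₁ V : CPer) (ℓ : CPer →L[ℝ] ℝ)
    (p : ℝ × (CPer × ℝ)) : CPer × ℝ :=
  (resolDeriv2 p.2.1 - d⁻¹ • (linPart ζ μ U (resol p.2.1)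
    + I • (V.translate p.2.2 * (U₁ + p.1 • resolDeriv p.2.1))
    - p.1 • ((2 : ℂ) • (U * (resol p.2.1 * conjCPer (resol p.2.1)))
      + conjCPer U * (resol p.2.1 * resol p.2.1))
    - p.1 ^ 2 • (resol p.2.1 * resol p.2.1 * conjCPer (resol p.2.1))), ℓ (resol p.2.1))

theorem contDiff_rescaledResidual (d ζ μ : ℝ) (U U₁ : CPer) {V V₁ : CPer} (hV : V.HasDeriv V₁)
    (ℓ : CPer →L[ℝ] ℝ) : ContDiff ℝ 1 (rescaledResidual d ζ μ U U₁ V ℓ) := by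
  have := hV.contDiff_translate
  unfold rescaledResidual
  fun_prop

theorem fderiv_rescaledResidual_comp_inr (d ζ μ : ℝ) (U U₁ : CPer) {V V₁ : CPer} (hV : V.HasDeriv V₁)
    (ℓ : CPer →L[ℝ] ℝ) (q : CPer × ℝ) :
    fderiv ℝ (rescaledResidual d ζ μ U U₁ V ℓ) (0, q) ∘L .inr ℝ ℝ (CPer × ℝ) =
      1 - compactPart d (linPart ζ μ U) (I • (V₁.translate q.2 * U₁)) ℓ := by
  -- The partial derivative is computed on the slice `ε = 0`, where the quadratic and cubic terms
  -- vanish and only `V.translate` depends on `σ`.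
  have h1 : HasFDerivAt (fun q : CPer × ℝ => rescaledResidual d ζ μ U U₁ V ℓ (0, q))
      (fderiv ℝ (rescaledResidual d ζ μ U U₁ V ℓ) (0, q) ∘L .inr ℝ ℝ (CPer × ℝ)) q :=
    HasFDerivAt.comp q
      ((contDiff_rescaledResidual d ζ μ U U₁ hV ℓ).differentiable one_ne_zero (0, q)).hasFDerivAt
      (hasFDerivAt_prodMk_right (0 : ℝ) q)
  have hT : HasFDerivAt (fun q : CPer × ℝ => V.translate q.2)
      ((ContinuousLinearMap.toSpanSingleton ℝ (V₁.translate q.2)) ∘L .snd ℝ CPer ℝ) q :=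
    HasFDerivAt.comp q (hV.hasDerivAt_translate q.2).hasFDerivAt hasFDerivAt_snd
  have h2 := ((resolDeriv2 ∘L .fst ℝ CPer ℝ).hasFDerivAt (x := q)).sub
    ((((linPart ζ μ U ∘L resol ∘L .fst ℝ CPer ℝ).hasFDerivAt (x := q)).add
      ((((ContinuousLinearMap.mul ℝ CPer).flip U₁).hasFDerivAt.comp q hT).const_smul I)).const_smul
        d⁻¹)
  have h3 := h2.prodMk ((ℓ ∘L resol ∘L .fst ℝ CPer ℝ).hasFDerivAt (x := q))
  have h4 : HasFDerivAt (fun q : CPer × ℝ => rescaledResidual d ζ μ U U₁ V ℓ (0, q)) _ q :=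
    h3.congr_of_eventuallyEq (Eventually.of_forall fun q => by
      simp [rescaledResidual, mul_comm])
  rw [h1.unique h4]
  refine ContinuousLinearMap.ext fun p => ?_
  rw [one_sub_compactPart_apply]
  simp [smul_comm I, mul_comm]

/-- The implicit function theorem, with a globally continuous branch and a Lipschitz estimate. -/
theorem exists_continuous_branch {E : Type*} [NormedAddCommGroup E] [NormedSpace ℝ E]
    [CompleteSpace E] {F : ℝ × E → E} {q : E} (hF : ContDiff ℝ 1 F) (h0 : F (0, q) = 0)
    (hinv : (fderiv ℝ F (0, q) ∘L .inr ℝ ℝ E).IsInvertible) :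
    ∃ r > 0, ∃ K : ℝ, 0 ≤ K ∧ ∃ ψ : ℝ → E, Continuous ψ ∧
      ∀ ε, |ε| ≤ r → F (ε, ψ ε) = 0 ∧ ‖ψ ε - q‖ ≤ K * |ε| := by
  have hF0 : ContDiffAt ℝ 1 F (0, q) := hF.contDiffAt
  set ψ := hF0.implicitFunction one_ne_zero hinv
  have hψ0 : ψ 0 = q := hF0.implicitFunction_apply_self one_ne_zero hinv
  have hψ1 : ContDiffAt ℝ 1 ψ 0 := hF0.contDiffAt_implicitFunction one_ne_zero hinv
  obtain ⟨K, t, ht, hK⟩ := hψ1.exists_lipschitzOnWith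
  have hev : ∀ᶠ ε in 𝓝 (0 : ℝ), ε ∈ t ∧ F (ε, ψ ε) = F (0, q) :=
    (eventually_mem_set.mpr ht).and (hF0.eventually_apply_implicitFunction one_ne_zero hinv)
  obtain ⟨r, hr, H⟩ := Metric.nhds_basis_closedBall.eventually_iff.mp hev
  have H' : ∀ ε, |ε| ≤ r → ε ∈ t ∧ F (ε, ψ ε) = F (0, q) := fun ε hε =>
    H (by simpa [Real.dist_eq] using hε)
  -- Clamping `ε` to `[-r, r]`, where the branch is Lipschitz, makes it continuous on all of `ℝ`
  -- without changing it there.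
  let c : ℝ → ℝ := fun ε => max (-r) (min r ε)
  have hc : ∀ ε, |c ε| ≤ r := fun ε =>
    abs_le.mpr ⟨le_max_left _ _, max_le (by linarith) (min_le_left _ _)⟩
  have hc' : ∀ ε, |ε| ≤ r → c ε = ε := fun ε hε => by
    rw [abs_le] at hε
    simp only [c]
    rw [min_eq_right hε.2, max_eq_right hε.1]
  refine ⟨r, hr, K, K.2, ψ ∘ c, ?_, fun ε hε => ?_⟩
  · exact hK.continuousOn.comp_continuous (by fun_prop) fun ε => (H' _ (hc ε)).1
  · simp only [Function.comp_apply, hc' ε hε]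
    refine ⟨(H' ε hε).2.trans h0, ?_⟩
    have := hK.norm_sub_le (H' ε hε).1 (H' 0 (by simpa using hr.le)).1
    rwa [hψ0, sub_zero, Real.norm_eq_abs] at this

/-- A zero of the residual yields a solution of the stationary equation. -/
theorem isSolution_of_rescaledResidual {d ζ μ f₀ : ℝ} (hd : d ≠ 0) {U U₁ U₂ V : CPer}
    (h₁ : U.HasDeriv U₁) (h₂ : U₁.HasDeriv U₂) {v : ℝ → ℝ} (hv : ∀ x : ℝ, V x = v x)
    (hU : ∀ x : ℝ, -(d : ℂ) * U₂ x + ((ζ : ℂ) - I * (μ : ℂ)) * U x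
        - U x * U x * (starRingEnd ℂ) (U x) + I * (f₀ : ℂ) = 0)
    {ℓ : CPer →L[ℝ] ℝ} {ε : ℝ} {q : CPer × ℝ}
    (hq : rescaledResidual d ζ μ U U₁ V ℓ (ε, q) = 0) :
    IsSolution d ζ μ f₀ ε v (fun x : ℝ => (U + ε • resol q.1) ((x - q.2 : ℝ))) := by
  have hf₁ := h₁.add_smul (hasDerivAt_resol q.1) ε
  have hf₂ := h₂.add_smul (hasDerivAt_resolDeriv q.1) ε
  refine ⟨memH2per_shift hf₁ hf₂ q.2, Eventually.of_forall fun x => ?_⟩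
  have hd' : (d : ℂ) ≠ 0 := by exact_mod_cast hd
  have h3 := DFunLike.congr_fun (congrArg Prod.fst hq) ((x - q.2 : ℝ) : AddCircle (2 * Real.pi))
  have h4 := hU (x - q.2)
  simp only [rescaledResidual, Prod.fst_zero, ContinuousMap.sub_apply, ContinuousMap.smul_apply,
    ContinuousMap.add_apply, ContinuousMap.mul_apply, linPart_apply, conjCPer_apply,
    CPer.translate_coe, sub_add_cancel, hv, real_smul, smul_eq_mul, ofReal_inv, ofReal_pow,
    ContinuousMap.zero_apply, sub_eq_zero (b := (d : ℂ)⁻¹ * _)] at h3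
  rw [eq_inv_mul_iff_mul_eq₀ hd'] at h3
  simp only [stationaryLHS]
  rw [hf₁.deriv_shift, hf₂.deriv_shift, norm_sq_mul_eq]
  simp only [ContinuousMap.smul_apply, ContinuousMap.add_apply, real_smul, map_add, map_mul,
    conj_ofReal]
  -- The full equation is the unperturbed one plus `ε` times the rescaled one, so `ε = 0` needs no
  -- separate treatment.
  linear_combination h4 - (ε : ℂ) * h3

/-! ### Estimates and continuity in the `H²` norm. -/

theorem CPer.norm_sub_translate_le {h k g : CPer} (H : h.HasDeriv k) {a b x : ℝ} :
    ‖(h + g) ((x - a : ℝ)) - h ((x - b : ℝ))‖ ≤ ‖k‖ * |a - b| + ‖g‖ := by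
  have h1 := norm_sub_le_of_hasDerivAt H (x - a) (x - b)
  have h2 := g.norm_coe_le_norm ((x - a : ℝ))
  rw [show x - a - (x - b) = -(a - b) by ring, abs_neg] at h1
  rw [ContinuousMap.add_apply, add_sub_right_comm]
  exact (norm_add_le _ _).trans (add_le_add h1 h2)

/-- Comparing second derivatives at two different shifts costs a third derivative, hence `U₃`. -/
theorem H2norm_sub_le {U U₁ U₂ U₃ W W₁ W₂ : CPer} (h₁ : U.HasDeriv U₁) (h₂ : U₁.HasDeriv U₂)
    (h₃ : U₂.HasDeriv U₃) (k₁ : W.HasDeriv W₁) (k₂ : W₁.HasDeriv W₂) (ε a b : ℝ) {M : ℝ}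
    (hM : 0 ≤ M) (b₀ : ‖U₁‖ * |a - b| + ‖ε • W‖ ≤ M) (b₁ : ‖U₂‖ * |a - b| + ‖ε • W₁‖ ≤ M)
    (b₂ : ‖U₃‖ * |a - b| + ‖ε • W₂‖ ≤ M) :
    H2norm (fun x : ℝ => (U + ε • W) ((x - a : ℝ)) - U ((x - b : ℝ))) ≤
      Real.sqrt (6 * Real.pi) * M := by
  have hf₁ := h₁.add_smul k₁ ε
  have hf₂ := h₂.add_smul k₂ ε
  exact H2norm_le (funext fun x => ((hf₁.shift a x).sub (h₁.shift b x)).deriv)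
    (funext fun x => ((hf₂.shift a x).sub (h₂.shift b x)).deriv) hM
    (fun x => (CPer.norm_sub_translate_le h₁).trans b₀)
    (fun x => (CPer.norm_sub_translate_le h₂).trans b₁)
    (fun x => (CPer.norm_sub_translate_le h₃).trans b₂)

theorem tendsto_H2norm_sub {P P₁ P₂ : ℝ → CPer} {σ : ℝ → ℝ} (hP : Continuous P)
    (hP₁ : Continuous P₁) (hP₂ : Continuous P₂) (hσ : Continuous σ)
    (h₁ : ∀ ε, (P ε).HasDeriv (P₁ ε)) (h₂ : ∀ ε, (P₁ ε).HasDeriv (P₂ ε)) (ε₁ : ℝ) :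
    Tendsto (fun ε => H2norm (fun x : ℝ => P ε ((x - σ ε : ℝ)) - P ε₁ ((x - σ ε₁ : ℝ))))
      (𝓝 ε₁) (𝓝 0) := by
  -- Evaluation is jointly continuous, so the squared norm is a parametric integral of a jointly
  -- continuous integrand, which vanishes at `ε₁`.
  have hj : ∀ Q : ℝ → CPer, Continuous Q →
      Continuous fun p : ℝ × ℝ => Q p.1 ((p.2 - σ p.1 : ℝ)) := fun Q hQ =>
    continuous_eval.comp ((hQ.comp continuous_fst).prodMk
      ((AddCircle.continuous_mk' _).comp (by fun_prop)))
  have hj' : ∀ Q : ℝ → CPer, Continuous fun p : ℝ × ℝ => Q ε₁ ((p.2 - σ ε₁ : ℝ)) := fun Q =>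
    (Q ε₁).continuous_coe.comp (by fun_prop)
  have hcont : Continuous fun ε => Real.sqrt (∫ x in (-Real.pi)..Real.pi,
      (‖P ε ((x - σ ε : ℝ)) - P ε₁ ((x - σ ε₁ : ℝ))‖ ^ 2
        + ‖P₁ ε ((x - σ ε : ℝ)) - P₁ ε₁ ((x - σ ε₁ : ℝ))‖ ^ 2
        + ‖P₂ ε ((x - σ ε : ℝ)) - P₂ ε₁ ((x - σ ε₁ : ℝ))‖ ^ 2)) := by
    refine Real.continuous_sqrt.comp ?_
    refine intervalIntegral.continuous_parametric_intervalIntegral_of_continuous' ?_ _ _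
    exact ((((hj P hP).sub (hj' P)).norm.pow 2).add (((hj P₁ hP₁).sub (hj' P₁)).norm.pow 2)).add
      (((hj P₂ hP₂).sub (hj' P₂)).norm.pow 2)
  have hd1 : ∀ ε, deriv (fun x : ℝ => P ε ((x - σ ε : ℝ)) - P ε₁ ((x - σ ε₁ : ℝ))) =
      fun x : ℝ => P₁ ε ((x - σ ε : ℝ)) - P₁ ε₁ ((x - σ ε₁ : ℝ)) := fun ε =>
    funext fun x => (((h₁ ε).shift (σ ε) x).sub ((h₁ ε₁).shift (σ ε₁) x)).deriv
  have hd2 : ∀ ε, deriv (fun x : ℝ => P₁ ε ((x - σ ε : ℝ)) - P₁ ε₁ ((x - σ ε₁ : ℝ))) =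
      fun x : ℝ => P₂ ε ((x - σ ε : ℝ)) - P₂ ε₁ ((x - σ ε₁ : ℝ)) := fun ε =>
    funext fun x => (((h₂ ε).shift (σ ε) x).sub ((h₂ ε₁).shift (σ ε₁) x)).deriv
  have := hcont.tendsto ε₁
  simp only [sub_self, norm_zero, ne_eq, OfNat.ofNat_ne_zero, not_false_eq_true, zero_pow,
    add_zero, intervalIntegral.integral_zero, Real.sqrt_zero] at this
  simpa only [H2norm, hd1, hd2] using this

end LLE

/-! ### Proof of the main theorem. -/

theorem mainTheorem1 (d f₀ ζ μ : ℝ) (hd : d ≠ 0)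
    (V : ℝ → ℝ) (hVper : Function.Periodic V (2 * Real.pi)) (hV : ContDiff ℝ 1 V)
    (u₀ : ℝ → ℂ) (hu₀ : LLE.IsNondegenerateSolution d ζ μ f₀ u₀)
    (φ₀ : ℝ → ℂ)
    (hφ₀ : LLE.kerAdjoint d ζ μ u₀ = (Submodule.span ℝ {φ₀} : Set (ℝ → ℂ)))
    (σ₀ : ℝ) (hzero : LLE.Veff V u₀ φ₀ σ₀ = 0)
    (hsimple : deriv (LLE.Veff V u₀ φ₀) σ₀ ≠ 0) :
    ∃ εs : ℝ, 0 < εs ∧ ∃ C : ℝ, 0 < C ∧ ∃ u : ℝ → ℝ → ℂ,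
      (∀ ε ∈ Set.Ioo (-εs) εs, LLE.IsSolution d ζ μ f₀ ε V (u ε)) ∧
      (∀ ε₁ ∈ Set.Ioo (-εs) εs,
        Tendsto (fun ε => LLE.H2norm (fun x => u ε x - u ε₁ x)) (𝓝 ε₁) (𝓝 0)) ∧
      (∀ ε ∈ Set.Ioo (-εs) εs,
        LLE.H2norm (fun x => u ε x - u₀ (x - σ₀)) ≤ C * |ε|) := by
  open LLE in
  obtain ⟨hsol, hnc, hker⟩ := hu₀
  obtain ⟨U, U₁, U₂, U₃, rfl, h₁, h₂, h₃, hU⟩ := hsol.exists_classical hd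
  obtain ⟨hφm, hφ⟩ : φ₀ ∈ kerAdjoint d ζ μ (fun x : ℝ => U x) := by
    rw [hφ₀]
    exact Submodule.mem_span_singleton_self φ₀
  let Φ : CPer := CPer.of φ₀ hφm.periodic hφm.contDiff.continuous
  have hV' := contDiff_one_iff_deriv.mp hV
  have hVper' : Function.Periodic (deriv V) (2 * Real.pi) := by
    intro x
    rw [← deriv_comp_add_const]
    congr 1
    exact funext hVper
  let W : CPer := CPer.of (fun x => (V x : ℂ)) (fun x => by simp only [hVper x])
    (by have := hV'.1.continuous; fun_prop)
  let W₁ : CPer := CPer.of (fun x => ((deriv V x : ℝ) : ℂ)) (fun x => by simp only [hVper' x])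
    (by have := hV'.2; fun_prop)
  have hW : W.HasDeriv W₁ := fun x => (hV'.1 x).hasDerivAt.ofReal_comp
  have hU₁ : deriv (fun x : ℝ => U x) = fun x : ℝ => U₁ x := h₁.deriv
  have hVeff : Veff V (fun x : ℝ => U x) φ₀ = fun s => pairing Φ (I • (W.translate s * U₁)) := by
    funext s
    rw [Veff, pairing_apply, hU₁]
    simp only [ContinuousMap.smul_apply, ContinuousMap.mul_apply, smul_eq_mul, mul_assoc]
    rfl
  have hVeff' : deriv (Veff V (fun x : ℝ => U x) φ₀) σ₀ =
      pairing Φ (I • (W₁.translate σ₀ * U₁)) := by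
    rw [hVeff]
    exact ((pairing Φ).hasFDerivAt.comp_hasDerivAt σ₀
      (((hW.hasDerivAt_translate σ₀).mul_const U₁).const_smul I)).deriv
  have hP : ∀ f f₁ f₂ : CPer, f.HasDeriv f₁ → f₁.HasDeriv f₂ →
      pairing Φ (linPart ζ μ U f - d • f₂) = 0 := by
    intro f f₁ f₂ hf₁ hf₂
    have := hφ _ (memH2per_coe hf₁ hf₂)
    rw [linOp_coe d ζ μ U hf₁ hf₂] at this
    rw [pairing_apply]
    exact this
  have hker' : ∀ f f₁ f₂ : CPer, f.HasDeriv f₁ → f₁.HasDeriv f₂ →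
      linPart ζ μ U f - d • f₂ = 0 → ∃ c : ℝ, f = c • U₁ := by
    intro f f₁ f₂ hf₁ hf₂ hf
    have hmem : (fun x : ℝ => f x) ∈ kerLinOp d ζ μ (fun x : ℝ => U x) := by
      refine ⟨memH2per_coe hf₁ hf₂, Eventually.of_forall fun x => ?_⟩
      rw [linOp_coe d ζ μ U hf₁ hf₂, hf]
      rfl
    rw [hker, SetLike.mem_coe, Submodule.mem_span_singleton] at hmem
    obtain ⟨c, hc⟩ := hmem
    refine ⟨c, CPer.ext_real fun x => ?_⟩
    have := congrFun hc x
    rw [hU₁] at this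
    exact this.symm
  obtain ⟨x₀, hx₀⟩ : ∃ x₀ : ℝ, U₁ x₀ ≠ 0 := by
    by_contra! h
    refine hnc ⟨U ((0 : ℝ)), fun x => ?_⟩
    exact is_const_of_deriv_eq_zero (fun y => (h₁ y).differentiableAt)
      (fun y => (h₁ y).deriv.trans (h y)) x 0
  -- Phase condition: the real inner product with `u₀'` at a point `x₀` where `u₀' ≠ 0`, which
  -- exists because `u₀` is non-constant.
  let ℓ : CPer →L[ℝ] ℝ := reCLM ∘L ContinuousLinearMap.mul ℝ ℂ ((starRingEnd ℂ) (U₁ x₀)) ∘L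
    ContinuousMap.evalCLM ℝ (x₀ : AddCircle (2 * Real.pi))
  have hℓ : ℓ U₁ ≠ 0 := by
    have : ℓ U₁ = normSq (U₁ x₀) := by
      change ((starRingEnd ℂ) (U₁ x₀) * U₁ x₀).re = _
      rw [← normSq_eq_conj_mul_self, ofReal_re]
    rw [this]
    exact (normSq_pos.mpr hx₀).ne'
  have hg : pairing Φ (I • (W₁.translate σ₀ * U₁)) ≠ 0 := hVeff' ▸ hsimple
  have hinv := isInvertible_linearization hd hP hker' hg hℓ
  -- Surjectivity of the bordered operator replaces a closed range argument: it solves `L w + s g +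
  -- k = 0`, and pairing with `φ₀*` gives `s V_eff'(σ₀) + V_eff(σ₀) = 0`. Hence `s = 0` and `w`
  -- solves the problem at `ε = 0`.
  obtain ⟨q, hq⟩ := hinv.surjective (d⁻¹ • (I • (W.translate σ₀ * U₁)), (0 : ℝ))
  obtain ⟨-, hq2⟩ := pairing_identity hd hP hq
  have hz : pairing Φ (I • (W.translate σ₀ * U₁)) = 0 := by
    rw [← hzero, hVeff]
  have hq2' : q.2 = 0 := by simpa [hz, hg] using hq2
  have hF0 : rescaledResidual d ζ μ U U₁ W ℓ (0, (q.1, σ₀)) = 0 := by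
    rw [one_sub_compactPart_apply, hq2', zero_smul, add_zero, Prod.mk.injEq] at hq
    simp only [rescaledResidual, zero_smul, add_zero, ne_eq, OfNat.ofNat_ne_zero, not_false_eq_true,
      zero_pow, sub_zero, smul_add, hq.2]
    rw [← sub_sub, hq.1, sub_self]
    rfl
  obtain ⟨r, hr, K, hK, ψ, hψc, hψ⟩ := exists_continuous_branch
    (contDiff_rescaledResidual d ζ μ U U₁ hW ℓ) hF0
    (by rw [fderiv_rescaledResidual_comp_inr d ζ μ U U₁ hW ℓ]; exact hinv)
  have hsum : ∀ ε : ℝ, ∀ L : CPer →L[ℝ] CPer, |ε| ≤ r →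
      ‖ε • L (ψ ε).1‖ ≤ (‖L‖ * (‖q.1‖ + K * r)) * |ε| := by
    intro ε L hε
    have h5 : ‖(ψ ε).1‖ ≤ ‖q.1‖ + K * r := by
      have h6 := (norm_fst_le (ψ ε - (q.1, σ₀))).trans (hψ ε hε).2
      have h7 := norm_le_norm_add_norm_sub' (ψ ε).1 q.1
      have h8 : K * |ε| ≤ K * r := by gcongr
      simp only [Prod.fst_sub] at h6
      linarith
    rw [norm_smul, Real.norm_eq_abs, mul_comm]
    gcongr
    exact (L.le_opNorm _).trans (by gcongr)
  have hshift : ∀ ε : ℝ, |ε| ≤ r → |(ψ ε).2 - σ₀| ≤ K * |ε| := fun ε hε =>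
    (norm_snd_le (ψ ε - (q.1, σ₀))).trans (hψ ε hε).2
  let B : ℝ := (‖U₁‖ + ‖U₂‖ + ‖U₃‖) * K +
    (‖resol‖ + ‖resolDeriv‖ + ‖resolDeriv2‖) * (‖q.1‖ + K * r)
  have hbound : ∀ ε : ℝ, |ε| ≤ r → ∀ (G : CPer) (L : CPer →L[ℝ] CPer),
      ‖G‖ ≤ ‖U₁‖ + ‖U₂‖ + ‖U₃‖ → ‖L‖ ≤ ‖resol‖ + ‖resolDeriv‖ + ‖resolDeriv2‖ →
      ‖G‖ * |(ψ ε).2 - σ₀| + ‖ε • L (ψ ε).1‖ ≤ B * |ε| := by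
    intro ε hε G L hG hL
    calc ‖G‖ * |(ψ ε).2 - σ₀| + ‖ε • L (ψ ε).1‖
        ≤ (‖U₁‖ + ‖U₂‖ + ‖U₃‖) * (K * |ε|) + ((‖resol‖ + ‖resolDeriv‖ + ‖resolDeriv2‖) *
          (‖q.1‖ + K * r)) * |ε| := by
          refine add_le_add (mul_le_mul hG (hshift ε hε) (abs_nonneg _) (by positivity))
            ((hsum ε L hε).trans ?_)
          gcongr
      _ = B * |ε| := by ring
  -- The `+ 1` only ensures that the constant is strictly positive.
  refine ⟨r, hr, Real.sqrt (6 * Real.pi) * B + 1, by positivity,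
    fun ε x => (U + ε • resol (ψ ε).1) ((x - (ψ ε).2 : ℝ)), fun ε hε => ?_, fun ε₁ _ => ?_,
    fun ε hε => ?_⟩
  · exact isSolution_of_rescaledResidual hd h₁ h₂ (fun x => rfl) hU (hψ ε (abs_lt.mpr hε).le).1
  · exact tendsto_H2norm_sub (P := fun ε => U + ε • resol (ψ ε).1)
      (P₁ := fun ε => U₁ + ε • resolDeriv (ψ ε).1) (P₂ := fun ε => U₂ + ε • resolDeriv2 (ψ ε).1)
      (σ := fun ε => (ψ ε).2) (by fun_prop) (by fun_prop) (by fun_prop) (by fun_prop)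
      (fun ε => h₁.add_smul (hasDerivAt_resol _) ε)
      (fun ε => h₂.add_smul (hasDerivAt_resolDeriv _) ε) ε₁
  · have hε' : |ε| ≤ r := (abs_lt.mpr hε).le
    have n₁ := norm_nonneg U₁
    have n₂ := norm_nonneg U₂
    have n₃ := norm_nonneg U₃
    have m₁ := norm_nonneg resol
    have m₂ := norm_nonneg resolDeriv
    have m₃ := norm_nonneg resolDeriv2
    have := H2norm_sub_le h₁ h₂ h₃ (hasDerivAt_resol (ψ ε).1) (hasDerivAt_resolDeriv (ψ ε).1)
      ε (ψ ε).2 σ₀ (M := B * |ε|) (by positivity)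
      (hbound ε hε' U₁ resol (by linarith) (by linarith))
      (hbound ε hε' U₂ resolDeriv (by linarith) (by linarith))
      (hbound ε hε' U₃ resolDeriv2 (by linarith) (by linarith))
    have h9 := abs_nonneg ε
    refine this.trans ?_
    linarith
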